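/- Let $\mathbb T^3=(\mathbb R/2\pi\mathbb Z)^3$ with Lebesgue measure, let $m>0$, and let $\hat v:\mathbb Z^3\to\mathbb R$ be even with $\lim_{|s|\to\infty}|s|^{3+\kappa}\hat v(s)=0$ for some $\kappa>1/2$. For $k\in(-\pi,\pi]^3$ let $H(k)=H_0(k)-V$ be the two-particle discrete Schrödinger operator with equal masses $m_1=m_2=m$ on $L^2(\mathbb T^3)$, where $$(H_0(k)f)(q)=E_k(q)f(q),\qquad E_k(q)=\frac1m\,\varepsilon\!\left(\tfrac k2+q\right)+\frac1m\,\varepsilon\!\left(\tfrac k2-q\right),\qquad \varepsilon(q)=\sum_{j=1}^3(1-\cos q^{(j)}),$$ $$(Vf)(q)=(2\pi)^{-3/2}\int_{\mathbb T^3}v(q-s)f(s)\,ds,\qquad v(q)=(2\pi)^{-3/2}\sum_{s\in\mathbb Z^3}\hat v(s)e^{i(q,s)},$$ and put $E_{\min}(k)=\min_{q\in\mathbb T^3}E_k(q)$. Suppose that $H(0)$ has the zero eigenvalue with multiplicity $n$. Then for every nonzero $k\in(-\pi,\pi)^3$ the operator $H(k)$ has at least $n$ eigenvalues (counted with multiplicity)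 below $E_{\min}(k)$. If, moreover, $H(0)$ is positive (that is, $(H(0)f,f)\ge 0$ for all $f$), these $n$ eigenvalues can all be taken nonnegative; in that case $H(k)$ has at least $n$ nonnegative eigenvalues below $E_{\min}(k)$. -/

import Mathlib

open MeasureTheory Filter Topology

noncomputable section

namespace LatticePair

/-- Positivity of the period of the circle `ℝ / 2πℤ`. -/
instance factTwoPiPos : Fact (0 < 2 * Real.pi) := ⟨Real.two_pi_pos⟩

/-- The three-dimensional torus `𝕋³ = (ℝ / 2πℤ)³`, with its Lebesgue measure of total mass
`(2π)³`. -/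
abbrev Torus : Type := Fin 3 → AddCircle (2 * Real.pi)

/-- The complex Hilbert space `L²(𝕋³)`. -/
abbrev L2 : Type := Lp ℂ 2 (volume : Measure Torus)

/-- The Euclidean length `|s|` of a lattice point `s ∈ ℤ³`. -/
def latticeNorm (s : Fin 3 → ℤ) : ℝ := Real.sqrt (∑ j, (s j : ℝ) ^ 2)

/-- The class of interactions: `vhat` is a real even function on `ℤ³` with
`|s| ^ (3 + κ) * vhat s → 0` as `|s| → ∞`, for some `κ > 1 / 2`. -/
def IsInteraction (vhat : (Fin 3 → ℤ) → ℝ) : Prop :=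
  (∀ s, vhat (-s) = vhat s) ∧
    ∃ κ : ℝ, 1 / 2 < κ ∧
      Tendsto (fun s => latticeNorm s ^ (3 + κ) * vhat s) (comap latticeNorm atTop) (𝓝 0)

/-- `ε(q) = ∑ⱼ (1 - cos qⱼ)` on the torus. -/
def dispersion (q : Torus) : ℝ := ∑ j, (1 - Real.Angle.cos (q j))

/-- The class of `k / 2` in the torus, for a real vector `k` (in `(-π, π]³`). -/
def halfMomentum (k : Fin 3 → ℝ) : Torus := fun j => ((k j / 2 : ℝ) : AddCircle (2 * Real.pi))

/-- `E_k(q) = ε(k/2 + q) / m₁ + ε(k/2 - q) / m₂`. -/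
def energy (m₁ m₂ : ℝ) (k : Fin 3 → ℝ) (q : Torus) : ℝ :=
  1 / m₁ * dispersion (halfMomentum k + q) + 1 / m₂ * dispersion (halfMomentum k - q)

/-- `E_min(k)`, the minimum of the continuous function `E_k` on the compact torus. -/
def energyMin (m₁ m₂ : ℝ) (k : Fin 3 → ℝ) : ℝ := ⨅ q : Torus, energy m₁ m₂ k q

/-- The character `q ↦ exp(i (q, s))` of the torus, `s ∈ ℤ³`. -/
def character (s : Fin 3 → ℤ) : C(Torus, ℂ) where
  toFun q := ∏ j, fourier (s j) (q j)
  continuous_toFun := by fun_prop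

/-- The kernel function `v(q) = (2π)^(-3/2) ∑ₛ vhat(s) exp(i (q, s))`. The series is taken in the
space of continuous functions with the supremum norm, where it converges absolutely for every
interaction, see `summable_kernel`. -/
def kernel (vhat : (Fin 3 → ℤ) → ℝ) : C(Torus, ℂ) :=
  (((2 * Real.pi) ^ (-(3 / 2) : ℝ) : ℝ) : ℂ) • ∑' s, (vhat s : ℂ) • character s

lemma summable_latticeNorm_rpow {r : ℝ} (hr : r < -3) : Summable fun s => latticeNorm s ^ r := by
  let b := (EuclideanSpace.basisFun (Fin 3) ℝ).toBasis
  let L := Submodule.span ℤ (Set.range b)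
  have h := ZLattice.summable_norm_rpow L r (by
    rw [ZLattice.rank ℝ L]
    simpa using hr)
  let g : (Fin 3 → ℤ) → L := fun s =>
    ⟨∑ j, s j • b j, Submodule.sum_mem _ fun j _ =>
      Submodule.smul_mem _ _ (Submodule.subset_span ⟨j, rfl⟩)⟩
  have hg (s : Fin 3 → ℤ) (j : Fin 3) : (g s : EuclideanSpace ℝ (Fin 3)) j = s j := by
    simp [g, b, Finset.sum_apply, Pi.single_apply]
  have hinj : Function.Injective g := fun s t hst => by
    funext j
    have := hg s j
    rw [hst, hg t j] at this
    exact Int.cast_injective (α := ℝ) this.symm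
  refine (h.comp_injective hinj).congr fun s => ?_
  simp [latticeNorm, EuclideanSpace.norm_eq, hg]

lemma tendsto_latticeNorm : Tendsto latticeNorm cofinite atTop := by
  have h : Tendsto (fun s : Fin 3 → ℤ => ‖s‖) cofinite atTop := by
    rw [← cocompact_eq_cofinite]
    exact tendsto_norm_cocompact_atTop
  refine tendsto_atTop_mono (fun s => ?_) h
  refine (pi_norm_le_iff_of_nonneg (Real.sqrt_nonneg _)).2 fun j => ?_
  rw [Int.norm_eq_abs, ← Real.sqrt_sq_eq_abs]
  exact Real.sqrt_le_sqrt (Finset.single_le_sum (f := fun j => (s j : ℝ) ^ 2)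
    (fun j _ => sq_nonneg _) (Finset.mem_univ j))

lemma summable_kernel {vhat : (Fin 3 → ℤ) → ℝ} (hv : IsInteraction vhat) :
    Summable fun s => ‖(vhat s : ℂ) • character s‖ := by
  obtain ⟨-, κ, hκ, hlim⟩ := hv
  have hlim' := hlim.mono_left (map_le_iff_le_comap.1 tendsto_latticeNorm)
  refine (summable_latticeNorm_rpow (r := -(3 + κ)) (by linarith)).of_norm_bounded_eventually ?_
  filter_upwards [hlim'.norm.eventually_le_const (u := 1) (by simp),
    tendsto_latticeNorm.eventually_gt_atTop 0] with s hs h0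
  have hc : ‖character s‖ ≤ 1 := by
    refine (ContinuousMap.norm_le _ zero_le_one).2 fun q => ?_
    simp [character, fourier_apply, Circle.norm_coe]
  rw [norm_norm, norm_smul, Complex.norm_real, Real.rpow_neg h0.le]
  rw [norm_mul, Real.norm_of_nonneg (Real.rpow_nonneg h0.le _)] at hs
  have hp : 0 < latticeNorm s ^ (3 + κ) := Real.rpow_pos_of_pos h0 _
  calc ‖vhat s‖ * ‖character s‖ ≤ ‖vhat s‖ := mul_le_of_le_one_right (norm_nonneg _) hc
    _ ≤ (latticeNorm s ^ (3 + κ))⁻¹ := by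
        rw [← one_div, le_div_iff₀ hp, mul_comm]
        exact hs

lemma continuous_dispersion : Continuous dispersion := by
  unfold dispersion
  refine continuous_finsetSum _ fun j _ => continuous_const.sub ?_
  exact Real.Angle.continuous_cos.comp (continuous_apply j)

lemma continuous_energy (m₁ m₂ : ℝ) (k : Fin 3 → ℝ) : Continuous (energy m₁ m₂ k) := by
  unfold energy
  exact (continuous_const.mul (continuous_dispersion.comp (by fun_prop))).add
    (continuous_const.mul (continuous_dispersion.comp (by fun_prop)))

lemma exists_energy_bound (m₁ m₂ : ℝ) (k : Fin 3 → ℝ) :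
    ∃ C : ℝ, ∀ q, ‖(energy m₁ m₂ k q : ℂ)‖ ≤ C := by
  obtain ⟨C, hC⟩ := isCompact_univ.exists_bound_of_continuousOn
    (Complex.continuous_ofReal.comp (continuous_energy m₁ m₂ k)).continuousOn
  exact ⟨C, fun q => hC q (Set.mem_univ q)⟩

lemma memLp_energy_mul (m₁ m₂ : ℝ) (k : Fin 3 → ℝ) (f : L2) :
    MemLp (fun q => (energy m₁ m₂ k q : ℂ) * f q) 2 (volume : Measure Torus) := by
  obtain ⟨C, hC⟩ := exists_energy_bound m₁ m₂ k
  refine (Lp.memLp f).of_le_mul (c := C) ?_ (Eventually.of_forall fun q => ?_)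
  · exact (Complex.continuous_ofReal.comp
      (continuous_energy m₁ m₂ k)).aestronglyMeasurable.mul (Lp.aestronglyMeasurable f)
  · rw [norm_mul]
    exact mul_le_mul_of_nonneg_right (hC q) (norm_nonneg _)

/-- The operator `H₀(k)` of multiplication by `E_k` on `L²(𝕋³)`. -/
def freeOp (m₁ m₂ : ℝ) (k : Fin 3 → ℝ) : L2 →L[ℂ] L2 :=
  LinearMap.mkContinuousOfExistsBound
    { toFun := fun f => (memLp_energy_mul m₁ m₂ k f).toLp
      map_add' := fun f g => by
        rw [← MemLp.toLp_add, MemLp.toLp_eq_toLp_iff]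
        filter_upwards [Lp.coeFn_add f g] with q hq
        rw [hq]
        simp [mul_add]
      map_smul' := fun c f => by
        rw [RingHom.id_apply, ← MemLp.toLp_const_smul, MemLp.toLp_eq_toLp_iff]
        filter_upwards [Lp.coeFn_smul c f] with q hq
        rw [hq]
        simp [mul_left_comm] }
    (by
      obtain ⟨C, hC⟩ := exists_energy_bound m₁ m₂ k
      refine ⟨C, fun f => Lp.norm_le_mul_norm_of_ae_le_mul ?_⟩
      filter_upwards [(memLp_energy_mul m₁ m₂ k f).coeFn_toLp] with q hq
      simp only [LinearMap.coe_mk, AddHom.coe_mk]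
      rw [hq, norm_mul]
      exact mul_le_mul_of_nonneg_right (hC q) (norm_nonneg _))

lemma integrable_kernel_mul (w : C(Torus, ℂ)) (f : L2) (q : Torus) :
    Integrable (fun s => w (q - s) * f s) (volume : Measure Torus) := by
  have hf : Integrable f (volume : Measure Torus) := (Lp.memLp f).integrable (by norm_num)
  refine hf.bdd_mul (c := ‖w‖) ?_ (Eventually.of_forall fun s => w.norm_coe_le_norm _)
  exact (w.continuous.comp (by fun_prop)).aestronglyMeasurable

/-- The function `q ↦ (2π)^(-3/2) ∫ w(q - s) f(s) ds`. -/
def convolve (w : C(Torus, ℂ)) (f : L2) (q : Torus) : ℂ :=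
  (((2 * Real.pi) ^ (-(3 / 2) : ℝ) : ℝ) : ℂ) * ∫ s, w (q - s) * f s

lemma continuous_convolve (w : C(Torus, ℂ)) (f : L2) : Continuous (convolve w f) := by
  have hf : Integrable f (volume : Measure Torus) := (Lp.memLp f).integrable (by norm_num)
  refine continuous_const.mul (continuous_of_dominated (bound := fun s => ‖w‖ * ‖f s‖)
    (fun q => (integrable_kernel_mul w f q).aestronglyMeasurable)
    (fun q => Eventually.of_forall fun s => ?_) (hf.norm.const_mul _)
    (Eventually.of_forall fun s => ?_))
  · rw [norm_mul]
    exact mul_le_mul_of_nonneg_right (w.norm_coe_le_norm _) (norm_nonneg _)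
  · exact (w.continuous.comp (by fun_prop)).mul continuous_const

lemma exists_convolve_bound (w : C(Torus, ℂ)) :
    ∃ C : ℝ, ∀ (f : L2) (q : Torus), ‖convolve w f q‖ ≤ C * ‖f‖ := by
  have h1 (f : L2) : ∫ s, ‖f s‖ ≤ ‖f‖ * (volume (Set.univ : Set Torus)).toReal ^ (1 / 2 : ℝ) := by
    have h := eLpNorm_le_eLpNorm_mul_rpow_measure_univ (p := 1) (q := 2) (by norm_num)
      (Lp.aestronglyMeasurable f)
    rw [integral_norm_eq_lintegral_enorm (Lp.aestronglyMeasurable f),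
      ← eLpNorm_one_eq_lintegral_enorm, Lp.norm_def, ENNReal.toReal_rpow, ← ENNReal.toReal_mul]
    refine ENNReal.toReal_mono (ENNReal.mul_ne_top (Lp.eLpNorm_ne_top f) ?_) ?_
    · exact ENNReal.rpow_ne_top_of_nonneg (by norm_num) (measure_ne_top _ _)
    · convert h using 3
      norm_num
  refine ⟨‖(((2 * Real.pi) ^ (-(3 / 2) : ℝ) : ℝ) : ℂ)‖ * (‖w‖ *
    (volume (Set.univ : Set Torus)).toReal ^ (1 / 2 : ℝ)), fun f q => ?_⟩
  have hf : Integrable f (volume : Measure Torus) := (Lp.memLp f).integrable (by norm_num)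
  rw [convolve, norm_mul, mul_assoc]
  refine mul_le_mul_of_nonneg_left ?_ (norm_nonneg _)
  calc ‖∫ s, w (q - s) * f s‖ ≤ ∫ s, ‖w‖ * ‖f s‖ := by
        refine norm_integral_le_of_norm_le (hf.norm.const_mul _) (Eventually.of_forall fun s => ?_)
        rw [norm_mul]
        exact mul_le_mul_of_nonneg_right (w.norm_coe_le_norm _) (norm_nonneg _)
    _ = ‖w‖ * ∫ s, ‖f s‖ := integral_const_mul _ _
    _ ≤ ‖w‖ * (‖f‖ * (volume (Set.univ : Set Torus)).toReal ^ (1 / 2 : ℝ)) :=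
        mul_le_mul_of_nonneg_left (h1 f) (norm_nonneg _)
    _ = _ := by ring

lemma memLp_convolve (w : C(Torus, ℂ)) (f : L2) :
    MemLp (convolve w f) 2 (volume : Measure Torus) := by
  obtain ⟨C, hC⟩ := exists_convolve_bound w
  exact MemLp.of_bound (continuous_convolve w f).aestronglyMeasurable (C * ‖f‖)
    (Eventually.of_forall fun q => hC f q)

/-- The operator `f ↦ (2π)^(-3/2) ∫ w(· - s) f(s) ds` on `L²(𝕋³)`. -/
def convolutionOp (w : C(Torus, ℂ)) : L2 →L[ℂ] L2 :=
  LinearMap.mkContinuousOfExistsBound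
    { toFun := fun f => (memLp_convolve w f).toLp
      map_add' := fun f g => by
        rw [← MemLp.toLp_add, MemLp.toLp_eq_toLp_iff]
        refine Eventually.of_forall fun q => ?_
        simp only [convolve, Pi.add_apply]
        rw [← mul_add, ← integral_add (integrable_kernel_mul w f q) (integrable_kernel_mul w g q)]
        congr 1
        refine integral_congr_ae ?_
        filter_upwards [Lp.coeFn_add f g] with s hs
        rw [hs]
        simp [mul_add]
      map_smul' := fun c f => by
        rw [RingHom.id_apply, ← MemLp.toLp_const_smul, MemLp.toLp_eq_toLp_iff]
        refine Eventually.of_forall fun q => ?_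
        simp only [convolve, Pi.smul_apply, smul_eq_mul]
        rw [mul_left_comm, ← integral_const_mul c]
        congr 1
        refine integral_congr_ae ?_
        filter_upwards [Lp.coeFn_smul c f] with s hs
        rw [hs]
        simp [mul_left_comm] }
    (by
      obtain ⟨C, hC⟩ := exists_convolve_bound w
      refine ⟨measureUnivNNReal (volume : Measure Torus) ^ (2 : ENNReal).toReal⁻¹ * C,
        fun f => ?_⟩
      rw [mul_assoc]
      refine Lp.norm_le_of_ae_bound ((norm_nonneg _).trans (hC f 0)) ?_
      filter_upwards [(memLp_convolve w f).coeFn_toLp] with q hq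
      simp only [LinearMap.coe_mk, AddHom.coe_mk]
      rw [hq]
      exact hC f q)

/-- The interaction operator `(V f)(q) = (2π)^(-3/2) ∫ v(q - s) f(s) ds`. -/
def interactionOp (vhat : (Fin 3 → ℤ) → ℝ) : L2 →L[ℂ] L2 := convolutionOp (kernel vhat)

/-- The two-particle discrete Schrödinger operator `H(k) = H₀(k) - V`. -/
def hamiltonian (m₁ m₂ : ℝ) (vhat : (Fin 3 → ℤ) → ℝ) (k : Fin 3 → ℝ) : L2 →L[ℂ] L2 :=
  freeOp m₁ m₂ k - interactionOp vhat

end LatticePair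

end

/-! For equal masses, E_k(q) = (2/m) ∑ⱼ (1 - cos(kⱼ/2) cos qⱼ). On the open cube the factors
cos(kⱼ/2) are nonnegative, so E_k(q) - E_min(k) ≤ (2/m) ∑ⱼ cos(kⱼ/2) (1 - cos qⱼ), which is strictly
below E_0(q) as soon as qᵢ ≠ 0 for some i with kᵢ ≠ 0, hence almost everywhere. So the form of H(k)
- E_min(k) is negative definite on the kernel of H(0) (`inner_hamiltonian_lt`).

Now H(k) - E_min(k) = M - V, with M ≥ 0 a multiplication operator and V compact and symmetric. A
variational argument (`exists_neg_eigenvector`), iterated by rank-one deflation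
(`exists_orthonormal_neg_eigenvectors`), turns an n-dimensional negative subspace into n orthonormal
eigenvectors with negative eigenvalues.

For the sign, E_k is the mean of the translates of E_0 by ±k/2, and V commutes with translations.
Hence H(0) ≥ 0 implies H(k) ≥ 0 (`inner_hamiltonian_nonneg`). -/

section CompactPerturbation

/-! ### Negative eigenvalues of compact perturbations of positive operators -/

variable {E : Type*} [NormedAddCommGroup E] [InnerProductSpace ℂ E]

open ContinuousLinearMap InnerProductSpace Filter Topology

/-- The Cauchy–Schwarz bound `‖B x‖² ≤ C ⟪B x, x⟫` for a positive operator of norm at most `C`. -/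
lemma ContinuousLinearMap.IsPositive.norm_sq_apply_le {B : E →L[ℂ] E} (hB : B.IsPositive) {C : ℝ}
    (hC : 0 < C) (hBC : ‖B‖ ≤ C) (x : E) : ‖B x‖ ^ 2 ≤ C * (inner ℂ (B x) x).re := by
  -- Expanding gives C²⟪Bx, x⟫ - 2C‖Bx‖² + ⟪BBx, Bx⟫ ≥ 0, whose last term is at most C‖Bx‖².
  have h := hB.re_inner_nonneg_left ((C : ℂ) • x - B x)
  have h1 : (inner ℂ (B (B x)) (B x)).re ≤ C * ‖B x‖ ^ 2 := by
    calc (inner ℂ (B (B x)) (B x)).re ≤ ‖inner ℂ (B (B x)) (B x)‖ := Complex.re_le_norm _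
      _ ≤ ‖B (B x)‖ * ‖B x‖ := norm_inner_le_norm _ _
      _ ≤ (C * ‖B x‖) * ‖B x‖ := by
        gcongr
        exact B.le_of_opNorm_le hBC _
      _ = C * ‖B x‖ ^ 2 := by ring
  have h2 : inner ℂ (B (B x)) x = inner ℂ (B x) (B x) := hB.isSymmetric (B x) x
  have h3 : inner ℂ (B x) (B x) = ((‖B x‖ ^ 2 : ℝ) : ℂ) := by
    rw [inner_self_eq_norm_sq_to_K]; push_cast; rfl
  simp only [map_sub, map_smul, inner_sub_left, inner_sub_right, inner_smul_left, inner_smul_right,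
    h2, h3, Complex.conj_ofReal, RCLike.re_to_complex, Complex.sub_re, Complex.re_ofReal_mul,
    Complex.ofReal_re] at h
  have h4 : 0 ≤ C * (C * (inner ℂ (B x) x).re - ‖B x‖ ^ 2) := by linarith
  linarith [nonneg_of_mul_nonneg_right h4 hC]

lemma isCompactOperator_rankOne (f g : E) : IsCompactOperator (rankOne ℂ f g) :=
  (isCompactOperator_of_locallyCompactSpace_rng (toSpanSingleton ℂ f)).comp_clm (innerSL ℂ g)

variable [CompleteSpace E]

/-- If the quadratic form of a compact symmetric perturbation of a positive operator takes a
negative value, then the perturbed operator has a negative eigenvalue. -/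
lemma exists_neg_eigenvector {M V : E →L[ℂ] E} (hM : M.IsPositive)
    (hV : (V : E →ₗ[ℂ] E).IsSymmetric) (hVc : IsCompactOperator V) {x₀ : E}
    (hx₀ : (inner ℂ ((M - V) x₀) x₀).re < 0) :
    ∃ (l : ℝ) (f : E), l < 0 ∧ ‖f‖ = 1 ∧ (M - V) f = (l : ℂ) • f := by
  set A := M - V with hA
  have hAs : (A : E →ₗ[ℂ] E).IsSymmetric := hM.isSymmetric.sub hV
  set S : Set ℝ := (fun x => (inner ℂ (A x) x).re) '' Metric.sphere 0 1 with hS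
  have hbdd : BddBelow S := by
    refine ⟨-‖A‖, ?_⟩
    rintro _ ⟨x, hx, rfl⟩
    have hx' : ‖x‖ = 1 := by simpa using hx
    have h1 : ‖inner ℂ (A x) x‖ ≤ ‖A‖ := by
      refine (norm_inner_le_norm _ _).trans ?_
      have := A.le_opNorm x
      rw [hx'] at this ⊢
      linarith
    exact (abs_le.1 ((Complex.abs_re_le_norm _).trans h1)).1
  have hscale (x : E) (hx : x ≠ 0) :
      ∃ y ∈ Metric.sphere (0 : E) 1, (inner ℂ (A x) x).re = ‖x‖ ^ 2 * (inner ℂ (A y) y).re := by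
    have hn : ‖x‖ ≠ 0 := norm_ne_zero_iff.2 hx
    refine ⟨((‖x‖⁻¹ : ℝ) : ℂ) • x, ?_, ?_⟩
    · simp [norm_smul, hn]
    · simp only [map_smul, inner_smul_left, inner_smul_right, Complex.conj_ofReal,
        Complex.re_ofReal_mul]
      field_simp
  -- The infimum of the form on the unit sphere is the eigenvalue sought; it remains to show that it
  -- is attained.
  set l := sInf S with hl
  have hlow (x : E) : l * ‖x‖ ^ 2 ≤ (inner ℂ (A x) x).re := by
    rcases eq_or_ne x 0 with rfl | hx
    · simp
    · obtain ⟨y, hy, hxy⟩ := hscale x hx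
      rw [hxy, mul_comm]
      exact mul_le_mul_of_nonneg_left (csInf_le hbdd ⟨y, hy, rfl⟩) (sq_nonneg _)
  have hne0 : x₀ ≠ 0 := by
    rintro rfl
    simp at hx₀
  have hl0 : l < 0 := by
    by_contra! h
    have := hlow x₀
    have := mul_nonneg h (sq_nonneg ‖x₀‖)
    linarith
  have hSne : S.Nonempty := by
    obtain ⟨y, hy, -⟩ := hscale x₀ hne0
    exact ⟨_, y, hy, rfl⟩
  obtain ⟨u, -, hu, huS⟩ := exists_seq_tendsto_sInf hSne hbdd
  choose x hx hxu using huS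
  have hxn (n : ℕ) : ‖x n‖ = 1 := by simpa using hx n
  set B := A - (l : ℂ) • (1 : E →L[ℂ] E) with hBdef
  have hBre (y : E) : (inner ℂ (B y) y).re = (inner ℂ (A y) y).re - l * ‖y‖ ^ 2 := by
    simp only [hBdef, _root_.sub_apply, _root_.smul_apply,
      one_apply_eq_self, inner_sub_left, inner_smul_left, Complex.conj_ofReal,
      Complex.sub_re, Complex.re_ofReal_mul]
    congr 2
    exact inner_self_eq_norm_sq (𝕜 := ℂ) y
  have hB : B.IsPositive := by
    refine ⟨hAs.sub fun y z => ?_, fun y => ?_⟩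
    · exact LinearMap.IsSymmetric.smul (Complex.conj_ofReal l) .id y z
    · change 0 ≤ (inner ℂ (B y) y).re
      rw [hBre]
      linarith [hlow y]
  -- Along the minimising sequence the form of B = A - l ≥ 0 tends to 0, and Cauchy–Schwarz upgrades
  -- this to B xₙ → 0. The 1 in ‖B‖ + 1 only keeps the constant positive.
  have hBx : Tendsto (fun n => B (x n)) atTop (𝓝 0) := by
    rw [tendsto_zero_iff_norm_tendsto_zero]
    have h1 : Tendsto (fun n => (‖B‖ + 1) * (u n - l)) atTop (𝓝 0) := by
      simpa [← hl] using (hu.sub_const l).const_mul (‖B‖ + 1)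
    have h2 : Tendsto (fun n => ‖B (x n)‖ ^ 2) atTop (𝓝 0) := by
      refine squeeze_zero (fun n => sq_nonneg _) (fun n => ?_) h1
      refine (hB.norm_sq_apply_le (C := ‖B‖ + 1) (by positivity) (by linarith) (x n)).trans_eq ?_
      rw [hBre, hxn, ← hxu]
      ring
    simpa using h2.sqrt
  obtain ⟨K, hK, hKV⟩ := hVc.image_closedBall_subset_compact (f := (V : E →ₗ[ℂ] E)) 1
  obtain ⟨g, -, φ, hφ, hg⟩ := hK.tendsto_subseq (x := fun n => V (x n)) fun n =>
    hKV ⟨x n, by simp [hxn n], rfl⟩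
  -- N = B + V converges along the subsequence. Since M ≥ 0 and l < 0, N is bounded below by -l, so
  -- the xₙ themselves are Cauchy there.
  set N := M - (l : ℂ) • (1 : E →L[ℂ] E) with hN
  have hNx : Tendsto (fun n => N (x (φ n))) atTop (𝓝 g) := by
    have := (hBx.comp hφ.tendsto_atTop).add hg
    rw [zero_add] at this
    refine this.congr fun n => ?_
    simp only [Function.comp, hN, hBdef, hA, _root_.sub_apply]
    abel
  have hNb (y : E) : ‖y‖ ≤ (-l)⁻¹ * ‖N y‖ := by
    have h1 : -l * ‖y‖ ^ 2 ≤ (inner ℂ (N y) y).re := by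
      simp only [hN, _root_.sub_apply, _root_.smul_apply,
        one_apply_eq_self, inner_sub_left, inner_smul_left, Complex.conj_ofReal,
        Complex.sub_re, Complex.re_ofReal_mul]
      have h2 : 0 ≤ (inner ℂ (M y) y).re := hM.re_inner_nonneg_left y
      have h3 : (inner ℂ y y).re = ‖y‖ ^ 2 := inner_self_eq_norm_sq (𝕜 := ℂ) y
      rw [h3]
      linarith
    have h4 : (inner ℂ (N y) y).re ≤ ‖N y‖ * ‖y‖ :=
      (Complex.re_le_norm _).trans (norm_inner_le_norm _ _)
    rw [inv_mul_eq_div, le_div_iff₀ (by linarith)]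
    rcases (norm_nonneg y).eq_or_lt with h | h
    · rw [← h]
      simp
    · nlinarith
  have hanti : AntilipschitzWith (Real.toNNReal (-l)⁻¹) N := by
    refine AddMonoidHomClass.antilipschitz_of_bound N fun y => ?_
    rw [Real.coe_toNNReal _ (by rw [inv_nonneg]; linarith)]
    exact hNb y
  have hcau : CauchySeq (x ∘ φ) := by
    rw [CauchySeq, ← (hanti.isUniformInducing N.uniformContinuous).cauchy_map_iff, map_map]
    exact hNx.cauchySeq
  obtain ⟨f, hf⟩ := cauchySeq_tendsto_of_complete hcau
  refine ⟨l, f, hl0, ?_, ?_⟩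
  · exact tendsto_nhds_unique hf.norm (by simp [hxn])
  · have h1 := tendsto_nhds_unique ((B.continuous.tendsto f).comp hf)
      (hBx.comp hφ.tendsto_atTop)
    simpa [hBdef, sub_eq_zero] using h1

/-- If the quadratic form of a compact symmetric perturbation of a positive operator is negative
definite on a subspace of dimension at least `n`, then the perturbed operator has at least `n`
negative eigenvalues, counted with multiplicity. -/
lemma exists_orthonormal_neg_eigenvectors {M : E →L[ℂ] E} (hM : M.IsPositive) (n : ℕ) :
    ∀ {V : E →L[ℂ] E}, (V : E →ₗ[ℂ] E).IsSymmetric → IsCompactOperator V →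
      ∀ (W : Submodule ℂ E) [FiniteDimensional ℂ W], n ≤ Module.finrank ℂ W →
      (∀ x ∈ W, x ≠ 0 → (inner ℂ ((M - V) x) x).re < 0) →
      ∃ (μ : Fin n → ℝ) (f : Fin n → E), Orthonormal ℂ f ∧
        ∀ i, μ i < 0 ∧ (M - V) (f i) = (μ i : ℂ) • f i := by
  induction n with
  | zero =>
    intro V _ _ W _ _ _
    exact ⟨Fin.elim0, Fin.elim0, ⟨fun i => i.elim0, fun i => i.elim0⟩, fun i => i.elim0⟩
  | succ n ih =>
    intro V hV hVc W _ hW hneg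
    have hne : W ≠ ⊥ := by
      rintro rfl
      simp at hW
    obtain ⟨x₀, hx₀W, hx₀⟩ := Submodule.exists_mem_ne_zero_of_ne_bot hne
    obtain ⟨l, f, hl, hf, hAf⟩ := exists_neg_eigenvector hM hV hVc (hneg x₀ hx₀W hx₀)
    -- Deflation: M - V' kills f and agrees with M - V on the orthogonal complement of f, while V'
    -- stays compact and symmetric. Intersecting W with that complement costs at most one dimension.
    set V' := V + (l : ℂ) • rankOne ℂ f f with hV'
    have hV's : (V' : E →ₗ[ℂ] E).IsSymmetric :=
      hV.add ((isSymmetric_rankOne_self f).smul (Complex.conj_ofReal l))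
    have hV'c : IsCompactOperator V' := hVc.add ((isCompactOperator_rankOne f f).smul (l : ℂ))
    have happ (x : E) : (M - V') x = (M - V) x - ((l : ℂ) * inner ℂ f x) • f := by
      simp only [hV', _root_.sub_apply, _root_.add_apply, _root_.smul_apply, rankOne_apply,
        smul_smul]
      abel
    let ψ : W →ₗ[ℂ] ℂ := (innerSL ℂ f : E →ₗ[ℂ] ℂ) ∘ₗ W.subtype
    let W' : Submodule ℂ E := (LinearMap.ker ψ).map W.subtype
    have hW'fin : n ≤ Module.finrank ℂ W' := by
      have h1 := LinearMap.finrank_range_add_finrank_ker ψ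
      have h2 : Module.finrank ℂ (LinearMap.range ψ) ≤ 1 :=
        (Submodule.finrank_le _).trans_eq (Module.finrank_self ℂ)
      have h3 : Module.finrank ℂ W' = Module.finrank ℂ (LinearMap.ker ψ) :=
        Submodule.finrank_map_subtype_eq W (LinearMap.ker ψ)
      omega
    obtain ⟨μ, g, hg, hμ⟩ := ih hV's hV'c W' hW'fin (by
      rintro _ ⟨x, hx, rfl⟩ hx0
      have h1 : inner ℂ f (x : E) = 0 := hx
      rw [happ]
      simpa [h1] using hneg x x.2 hx0)
    have hAs : ((M - V' : E →L[ℂ] E) : E →ₗ[ℂ] E).IsSymmetric := hM.isSymmetric.sub hV's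
    have hf0 : (M - V') f = 0 := by
      rw [happ, hAf, inner_self_eq_norm_sq_to_K, hf]
      simp
    -- f has eigenvalue 0 for the deflated operator and g i a negative one, so they are orthogonal;
    -- hence g i is also an eigenvector of M - V.
    have horth (i : Fin n) : inner ℂ f (g i) = 0 := by
      have h1 : inner ℂ ((M - V') f) (g i) = inner ℂ f ((M - V') (g i)) := hAs f (g i)
      rw [hf0, (hμ i).2, inner_zero_left, inner_smul_right] at h1
      refine (mul_eq_zero.1 h1.symm).resolve_left ?_
      exact_mod_cast (hμ i).1.ne
    refine ⟨Fin.cons l μ, Fin.cons f g, ?_, fun i => ?_⟩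
    · refine ⟨fun i => ?_, fun i j hij => ?_⟩
      · cases i using Fin.cases with
        | zero => simpa using hf
        | succ i => simpa using hg.1 i
      · cases i using Fin.cases with
        | zero =>
          cases j using Fin.cases with
          | zero => exact absurd rfl hij
          | succ j => simpa using horth j
        | succ i =>
          cases j using Fin.cases with
          | zero => simpa using inner_eq_zero_symm.1 (horth i)
          | succ j => simpa using hg.2 fun h => hij (congrArg Fin.succ h)
    · cases i using Fin.cases with
      | zero => exact ⟨by simpa using hl, by simpa using hAf⟩
      | succ i =>
        refine ⟨by simpa using (hμ i).1, ?_⟩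
        have h1 := (hμ i).2
        rw [happ, horth i] at h1
        simpa using h1

end CompactPerturbation

/-! ### Compactness and symmetry of the interaction -/

noncomputable section

namespace LatticePair

open InnerProductSpace

lemma integral_norm_le (f : L2) :
    ∫ s, ‖f s‖ ≤ (volume (Set.univ : Set Torus)).toReal ^ (1 / 2 : ℝ) * ‖f‖ := by
  have h := eLpNorm_le_eLpNorm_mul_rpow_measure_univ (p := 1) (q := 2) (by norm_num)
    (Lp.aestronglyMeasurable f)
  rw [mul_comm _ ‖f‖, integral_norm_eq_lintegral_enorm (Lp.aestronglyMeasurable f),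
    ← eLpNorm_one_eq_lintegral_enorm, Lp.norm_def, ENNReal.toReal_rpow, ← ENNReal.toReal_mul]
  refine ENNReal.toReal_mono (ENNReal.mul_ne_top (Lp.eLpNorm_ne_top f) ?_) ?_
  · exact ENNReal.rpow_ne_top_of_nonneg (by norm_num) (measure_ne_top _ _)
  · convert h using 3
    norm_num

lemma coeFn_convolutionOp (w : C(Torus, ℂ)) (f : L2) :
    (convolutionOp w f : Torus → ℂ) =ᵐ[volume] convolve w f :=
  (memLp_convolve w f).coeFn_toLp

lemma coeFn_freeOp (m₁ m₂ : ℝ) (k : Fin 3 → ℝ) (f : L2) :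
    (freeOp m₁ m₂ k f : Torus → ℂ) =ᵐ[volume] fun q => (energy m₁ m₂ k q : ℂ) * f q :=
  (memLp_energy_mul m₁ m₂ k f).coeFn_toLp

/-- The constant is uniform in the kernel w, which makes the operator depend continuously on w and
lets the series of v pass through. -/
lemma exists_norm_convolutionOp_le : ∃ C : ℝ, ∀ w : C(Torus, ℂ), ‖convolutionOp w‖ ≤ C * ‖w‖ := by
  set c : ℝ := ‖(((2 * Real.pi) ^ (-(3 / 2) : ℝ) : ℝ) : ℂ)‖
  set K : ℝ := (volume (Set.univ : Set Torus)).toReal ^ (1 / 2 : ℝ)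
  set L : ℝ := measureUnivNNReal (volume : Measure Torus) ^ (2 : ENNReal).toReal⁻¹
  have hc : 0 ≤ c := norm_nonneg _
  have hK : 0 ≤ K := Real.rpow_nonneg ENNReal.toReal_nonneg _
  have hL : 0 ≤ L := Real.rpow_nonneg (NNReal.coe_nonneg _) _
  refine ⟨L * (c * K), fun w => ContinuousLinearMap.opNorm_le_bound _ (by positivity) fun f => ?_⟩
  have hf : Integrable f (volume : Measure Torus) := (Lp.memLp f).integrable (by norm_num)
  have hb (q : Torus) : ‖convolve w f q‖ ≤ c * (‖w‖ * (K * ‖f‖)) := by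
    rw [convolve, norm_mul]
    refine mul_le_mul_of_nonneg_left ?_ hc
    calc ‖∫ s, w (q - s) * f s‖ ≤ ∫ s, ‖w‖ * ‖f s‖ := by
          refine norm_integral_le_of_norm_le (hf.norm.const_mul _) (Eventually.of_forall fun s => ?_)
          rw [norm_mul]
          exact mul_le_mul_of_nonneg_right (w.norm_coe_le_norm _) (norm_nonneg _)
      _ = ‖w‖ * ∫ s, ‖f s‖ := integral_const_mul _ _
      _ ≤ ‖w‖ * (K * ‖f‖) := mul_le_mul_of_nonneg_left (integral_norm_le f) (norm_nonneg _)
  have h : ‖convolutionOp w f‖ ≤ L * (c * (‖w‖ * (K * ‖f‖))) := by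
    refine Lp.norm_le_of_ae_bound (by positivity) ?_
    filter_upwards [coeFn_convolutionOp w f] with q hq
    rw [hq]
    exact hb q
  exact h.trans_eq (by ring)

/-- Convolution operators depend continuously and linearly on the kernel. -/
def convolutionCLM : C(Torus, ℂ) →L[ℂ] L2 →L[ℂ] L2 :=
  LinearMap.mkContinuousOfExistsBound
    { toFun := convolutionOp
      map_add' := fun w w' => by
        ext1 f
        refine Lp.ext ?_
        filter_upwards [coeFn_convolutionOp (w + w') f, coeFn_convolutionOp w f,
          coeFn_convolutionOp w' f, Lp.coeFn_add (convolutionOp w f) (convolutionOp w' f)]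
          with q h1 h2 h3 h4
        rw [_root_.add_apply, h1, h4, Pi.add_apply, h2, h3, convolve, convolve, convolve, ← mul_add,
          ← integral_add (integrable_kernel_mul w f q) (integrable_kernel_mul w' f q)]
        simp [add_mul]
      map_smul' := fun a w => by
        ext1 f
        refine Lp.ext ?_
        filter_upwards [coeFn_convolutionOp (a • w) f, coeFn_convolutionOp w f,
          Lp.coeFn_smul a (convolutionOp w f)] with q h1 h2 h3
        rw [RingHom.id_apply, _root_.smul_apply, h1, h3, Pi.smul_apply, h2, convolve, convolve,
          smul_eq_mul, mul_left_comm, ← integral_const_mul a]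
        simp [mul_assoc] }
    exists_norm_convolutionOp_le

lemma convolutionCLM_apply (w : C(Torus, ℂ)) : convolutionCLM w = convolutionOp w := rfl

/-- The character `s` as an element of `L²(𝕋³)`. -/
def characterLp (s : Fin 3 → ℤ) : L2 := ContinuousMap.toLp 2 volume ℂ (character s)

lemma character_sub (s : Fin 3 → ℤ) (q t : Torus) :
    character s (q - t) = character s q * starRingEnd ℂ (character s t) := by
  simp only [character, ContinuousMap.coe_mk, map_prod, ← Finset.prod_mul_distrib, Pi.sub_apply]
  refine Finset.prod_congr rfl fun j _ => ?_
  rw [← fourier_neg]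
  simp only [fourier_apply, ← Circle.coe_mul, ← AddCircle.toCircle_add]
  congr 2
  rw [smul_sub, neg_smul, sub_eq_add_neg]

/-- A character splits the kernel into separate factors in q and t, so the convolution has rank one.
-/
lemma convolutionOp_character (s : Fin 3 → ℤ) :
    convolutionOp (character s) = (((2 * Real.pi) ^ (-(3 / 2) : ℝ) : ℝ) : ℂ) •
      rankOne ℂ (characterLp s) (characterLp s) := by
  ext1 f
  refine Lp.ext ?_
  have hX : (characterLp s : Torus → ℂ) =ᵐ[volume] character s :=
    ContinuousMap.coeFn_toLp volume (character s)
  have hin : inner ℂ (characterLp s) f = ∫ t, starRingEnd ℂ (character s t) * f t := by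
    rw [L2.inner_def]
    refine integral_congr_ae ?_
    filter_upwards [hX] with t ht
    rw [ht, RCLike.inner_apply, mul_comm]
  filter_upwards [coeFn_convolutionOp (character s) f, hX,
    Lp.coeFn_smul (((2 * Real.pi) ^ (-(3 / 2) : ℝ) : ℝ) : ℂ)
      (inner ℂ (characterLp s) f • characterLp s),
    Lp.coeFn_smul (inner ℂ (characterLp s) f) (characterLp s)] with q h1 h2 h3 h4
  rw [h1, _root_.smul_apply, rankOne_apply, h3, Pi.smul_apply, h4, Pi.smul_apply, h2, hin, convolve,
    smul_eq_mul, smul_eq_mul]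
  congr 1
  rw [mul_comm _ (character s q), ← integral_const_mul]
  refine integral_congr_ae (Eventually.of_forall fun t => ?_)
  simp only [character_sub, mul_assoc]

/-- The decay of `vhat` makes the series of v converge in sup norm, so V is an operator-norm
convergent series of rank-one operators. Compactness and, the coefficients being real, symmetry pass
to the limit. -/
lemma interactionOp_eq {vhat : (Fin 3 → ℤ) → ℝ} (hv : IsInteraction vhat) :
    interactionOp vhat = (((2 * Real.pi) ^ (-(3 / 2) : ℝ) : ℝ) : ℂ) •
      ∑' s, (vhat s : ℂ) • (((2 * Real.pi) ^ (-(3 / 2) : ℝ) : ℝ) : ℂ) •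
        rankOne ℂ (characterLp s) (characterLp s) := by
  rw [interactionOp, ← convolutionCLM_apply, kernel, map_smul,
    ContinuousLinearMap.map_tsum _ (summable_kernel hv).of_norm]
  simp only [map_smul, convolutionCLM_apply, convolutionOp_character]

lemma isCompactOperator_interactionOp {vhat : (Fin 3 → ℤ) → ℝ} (hv : IsInteraction vhat) :
    IsCompactOperator (interactionOp vhat) := by
  have h : interactionOp vhat ∈ compactOperator (RingHom.id ℂ) L2 L2 := by
    rw [interactionOp_eq hv]
    refine Submodule.smul_mem _ _ (tsum_mem isClosed_setOfPred_isCompactOperator fun s => ?_)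
    exact Submodule.smul_mem _ _ (Submodule.smul_mem _ _ (isCompactOperator_rankOne _ _))
  exact h

lemma isSymmetric_interactionOp {vhat : (Fin 3 → ℤ) → ℝ} (hv : IsInteraction vhat) :
    (interactionOp vhat : L2 →ₗ[ℂ] L2).IsSymmetric := by
  rw [← ContinuousLinearMap.isSelfAdjoint_iff_isSymmetric, interactionOp_eq hv]
  have hr (r : ℝ) : IsSelfAdjoint (r : ℂ) := Complex.conj_ofReal r
  refine (hr _).smul ?_
  have hcl : IsClosed ((selfAdjoint (L2 →L[ℂ] L2) : AddSubgroup _) : Set (L2 →L[ℂ] L2)) :=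
    isClosed_eq continuous_star continuous_id
  refine tsum_mem hcl fun s => (hr _).smul ((hr _).smul ?_)
  exact (ContinuousLinearMap.isSelfAdjoint_iff_isSymmetric).2 (isSymmetric_rankOne_self _)

/-! ### Quadratic form of the free operator -/

lemma integrable_mul_norm_sq {g : Torus → ℝ} (hg : Continuous g) (f : L2) :
    Integrable (fun q => g q * ‖f q‖ ^ 2) (volume : Measure Torus) := by
  obtain ⟨C, hC⟩ := isCompact_univ.exists_bound_of_continuousOn hg.continuousOn
  exact (Lp.memLp f).norm.integrable_sq.bdd_mul hg.aestronglyMeasurable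
    (Eventually.of_forall fun q => hC q (Set.mem_univ q))

lemma norm_sq_eq_integral (f : L2) : ‖f‖ ^ 2 = ∫ q, ‖f q‖ ^ 2 := by
  have h : ((‖f‖ ^ 2 : ℝ) : ℂ) = ((∫ q, ‖f q‖ ^ 2 : ℝ) : ℂ) := by
    rw [← integral_complex_ofReal]
    have := inner_self_eq_norm_sq_to_K (𝕜 := ℂ) f
    rw [L2.inner_def] at this
    push_cast
    rw [← RCLike.ofReal_eq_complex_ofReal, ← this]
    refine integral_congr_ae (Eventually.of_forall fun q => ?_)
    simp [inner_self_eq_norm_sq_to_K]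
  exact_mod_cast h

lemma inner_freeOp_self (m₁ m₂ : ℝ) (k : Fin 3 → ℝ) (f : L2) :
    inner ℂ (freeOp m₁ m₂ k f) f = ((∫ q, energy m₁ m₂ k q * ‖f q‖ ^ 2 : ℝ) : ℂ) := by
  rw [L2.inner_def, ← integral_complex_ofReal]
  refine integral_congr_ae ?_
  filter_upwards [coeFn_freeOp m₁ m₂ k f] with q hq
  rw [hq, ← smul_eq_mul, inner_smul_left, Complex.conj_ofReal, inner_self_eq_norm_sq_to_K]
  simp

lemma energyMin_le (m₁ m₂ : ℝ) (k : Fin 3 → ℝ) (q : Torus) : energyMin m₁ m₂ k ≤ energy m₁ m₂ k q :=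
  ciInf_le (isCompact_range (continuous_energy m₁ m₂ k)).bddBelow q

lemma inner_freeOp_sub_energyMin_self (m₁ m₂ : ℝ) (k : Fin 3 → ℝ) (f : L2) :
    inner ℂ ((freeOp m₁ m₂ k - (energyMin m₁ m₂ k : ℂ) • 1) f) f =
      ((∫ q, (energy m₁ m₂ k q - energyMin m₁ m₂ k) * ‖f q‖ ^ 2 : ℝ) : ℂ) := by
  have h := integral_sub (integrable_mul_norm_sq (continuous_energy m₁ m₂ k) f)
    (integrable_mul_norm_sq (g := fun _ => energyMin m₁ m₂ k) continuous_const f)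
  simp only [sub_mul]
  rw [h, integral_const_mul, ← norm_sq_eq_integral, _root_.sub_apply, _root_.smul_apply,
    one_apply_eq_self, inner_sub_left, inner_smul_left, inner_freeOp_self,
    inner_self_eq_norm_sq_to_K, Complex.conj_ofReal]
  simp

lemma isPositive_freeOp_sub_energyMin (m₁ m₂ : ℝ) (k : Fin 3 → ℝ) :
    (freeOp m₁ m₂ k - (energyMin m₁ m₂ k : ℂ) • 1).IsPositive := by
  refine (ContinuousLinearMap.isPositive_iff_complex _).2 fun f => ?_
  rw [inner_freeOp_sub_energyMin_self]
  refine ⟨by simp, ?_⟩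
  simp only [RCLike.re_to_complex, Complex.ofReal_re]
  exact integral_nonneg fun q =>
    mul_nonneg (sub_nonneg.2 (energyMin_le m₁ m₂ k q)) (sq_nonneg _)

/-! ### Translations of the torus -/

/-- Translation of an `L²` function on the torus. -/
def translate (a : Torus) (f : L2) : L2 :=
  Lp.compMeasurePreserving (fun q => q + a) (measurePreserving_add_right volume a) f

lemma coeFn_translate (a : Torus) (f : L2) :
    (translate a f : Torus → ℂ) =ᵐ[volume] fun q => f (q + a) :=
  Lp.coeFn_compMeasurePreserving f (measurePreserving_add_right volume a)

lemma inner_translate (a : Torus) (f g : L2) :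
    inner ℂ (translate a f) (translate a g) = inner ℂ f g := by
  rw [L2.inner_def, L2.inner_def,
    ← integral_add_right_eq_self (fun q => inner ℂ (f q) (g q)) a]
  refine integral_congr_ae ?_
  filter_upwards [coeFn_translate a f, coeFn_translate a g] with q h1 h2
  rw [h1, h2]

lemma convolutionOp_translate (w : C(Torus, ℂ)) (a : Torus) (f : L2) :
    convolutionOp w (translate a f) = translate a (convolutionOp w f) := by
  refine Lp.ext ?_
  filter_upwards [coeFn_convolutionOp w (translate a f), coeFn_translate a (convolutionOp w f),
    (measurePreserving_add_right volume a).quasiMeasurePreserving.ae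
      (coeFn_convolutionOp w f)] with q h1 h2 h3
  rw [h1, h2, h3, convolve, convolve,
    ← integral_add_right_eq_self (fun s => w (q + a - s) * f s) a]
  congr 1
  refine integral_congr_ae ?_
  filter_upwards [coeFn_translate a f] with t ht
  rw [ht, add_sub_add_right_eq_sub]

lemma inner_freeOp_translate (m₁ m₂ : ℝ) (k : Fin 3 → ℝ) (a : Torus) (f : L2) :
    inner ℂ (freeOp m₁ m₂ k (translate a f)) (translate a f) =
      ((∫ q, energy m₁ m₂ k (q - a) * ‖f q‖ ^ 2 : ℝ) : ℂ) := by
  rw [inner_freeOp_self, ← integral_add_right_eq_self (fun q => energy m₁ m₂ k (q - a) * _) a]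
  congr 1
  refine integral_congr_ae ?_
  filter_upwards [coeFn_translate a f] with q hq
  rw [hq, add_sub_cancel_right]

/-! ### Comparison of E_k with E_0 -/

lemma dispersion_neg (q : Torus) : dispersion (-q) = dispersion q := by
  simp only [dispersion, Pi.neg_apply]
  exact Finset.sum_congr rfl fun j _ => congrArg (1 - ·) (Real.Angle.cos_neg (q j))

lemma halfMomentum_zero : halfMomentum 0 = 0 := by
  funext j
  simp [halfMomentum]

/-- For equal masses `E_k` is the mean of two translates of `E_0`. -/
lemma energy_eq_average (m : ℝ) (k : Fin 3 → ℝ) (q : Torus) :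
    energy m m k q =
      (energy m m 0 (q - halfMomentum k) + energy m m 0 (q - -halfMomentum k)) / 2 := by
  simp only [energy, halfMomentum_zero, zero_add, zero_sub, dispersion_neg, sub_neg_eq_add]
  rw [← dispersion_neg (q - halfMomentum k), neg_sub, add_comm (halfMomentum k) q]
  ring

lemma angle_cos_add_add_cos_sub (x : ℝ) (θ : Real.Angle) :
    Real.Angle.cos (x + θ) + Real.Angle.cos (x - θ) = 2 * (Real.cos x * θ.cos) := by
  rw [sub_eq_add_neg, Real.Angle.cos_add, Real.Angle.cos_add, Real.Angle.cos_neg,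
    Real.Angle.sin_neg, Real.Angle.cos_coe]
  ring

lemma energy_eq_sum (m : ℝ) (k : Fin 3 → ℝ) (q : Torus) :
    energy m m k q = 2 / m * ∑ j, (1 - Real.cos (k j / 2) * Real.Angle.cos (q j)) := by
  rw [energy, ← mul_add, dispersion, dispersion, ← Finset.sum_add_distrib, div_eq_mul_one_div 2 m,
    mul_comm 2 (1 / m), mul_assoc, Finset.mul_sum _ _ (2 : ℝ)]
  congr 1
  refine Finset.sum_congr rfl fun j _ => ?_
  have h : Real.Angle.cos ((halfMomentum k + q) j) + Real.Angle.cos ((halfMomentum k - q) j) = _ :=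
    angle_cos_add_add_cos_sub (k j / 2) (q j)
  linarith

lemma angle_cos_le_one (θ : Real.Angle) : θ.cos ≤ 1 := by
  induction θ using Real.Angle.induction_on with
  | _ x => exact Real.cos_le_one x

lemma angle_cos_lt_one {θ : Real.Angle} (hθ : θ ≠ 0) : θ.cos < 1 := by
  refine lt_of_le_of_ne (angle_cos_le_one θ) fun h => hθ ?_
  rw [← Real.Angle.cos_zero, Real.Angle.cos_eq_iff_eq_or_eq_neg] at h
  simpa using h

/-- Because cos(kⱼ/2) ≥ 0 on the cube, each summand is least at qⱼ = 0. -/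
lemma le_energyMin {m : ℝ} (hm : 0 < m) {k : Fin 3 → ℝ}
    (hk : ∀ j, k j ∈ Set.Ioo (-Real.pi) Real.pi) :
    2 / m * ∑ j, (1 - Real.cos (k j / 2)) ≤ energyMin m m k := by
  refine le_ciInf fun q => ?_
  rw [energy_eq_sum]
  refine mul_le_mul_of_nonneg_left (Finset.sum_le_sum fun j _ => ?_) (by positivity)
  have h1 : 0 ≤ Real.cos (k j / 2) :=
    Real.cos_nonneg_of_neg_pi_div_two_le_of_le (by linarith [(hk j).1]) (by linarith [(hk j).2])
  nlinarith [angle_cos_le_one (q j)]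

lemma energy_sub_energyMin_lt {m : ℝ} (hm : 0 < m) {k : Fin 3 → ℝ}
    (hk : ∀ j, k j ∈ Set.Ioo (-Real.pi) Real.pi) {i : Fin 3} (hi : k i ≠ 0) {q : Torus}
    (hq : q i ≠ 0) : energy m m k q - energyMin m m k < energy m m 0 q := by
  have h1 := le_energyMin hm hk
  have h2 : 0 < ∑ j, (1 - Real.cos (k j / 2)) * (1 - Real.Angle.cos (q j)) := by
    refine Finset.sum_pos' (fun j _ => ?_) ⟨i, Finset.mem_univ i, ?_⟩
    · exact mul_nonneg (sub_nonneg.2 (Real.cos_le_one _)) (sub_nonneg.2 (angle_cos_le_one _))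
    · refine mul_pos (sub_pos.2 (lt_of_le_of_ne (Real.cos_le_one _) fun h => hi ?_))
        (sub_pos.2 (angle_cos_lt_one hq))
      have h3 := (Real.cos_eq_one_iff_of_lt_of_lt (by linarith [(hk i).1, Real.pi_pos])
        (by linarith [(hk i).2, Real.pi_pos])).1 h
      linarith
  have h3 := mul_pos (div_pos two_pos hm) h2
  -- Termwise: (1 - a)(1 - c) = (1 - c) - (1 - ac) + (1 - a), with a = cos(kⱼ/2) and c = cos qⱼ.
  have h4 : 2 / m * ∑ j, (1 - Real.cos (k j / 2)) * (1 - Real.Angle.cos (q j)) =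
      energy m m 0 q - energy m m k q + 2 / m * ∑ j, (1 - Real.cos (k j / 2)) := by
    rw [energy_eq_sum, energy_eq_sum, ← mul_sub, ← mul_add, ← Finset.sum_sub_distrib,
      ← Finset.sum_add_distrib]
    congr 1
    refine Finset.sum_congr rfl fun j _ => ?_
    simp only [Pi.zero_apply, zero_div, Real.cos_zero]
    ring
  linarith

/-- The energy comparison is strict only off this hyperplane, which is null because points of the
circle are. -/
lemma ae_apply_ne_zero (i : Fin 3) : ∀ᵐ q : Torus, q i ≠ 0 := by
  have : NullSingletonClass (volume : Measure (AddCircle (2 * Real.pi))) := ⟨fun x => by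
    rw [← Metric.closedBall_zero, AddCircle.volume_closedBall]
    simp [Real.pi_pos.le]⟩
  exact Measure.ae_eval_ne (fun _ : Fin 3 => (volume : Measure (AddCircle (2 * Real.pi)))) i 0

/-! ### Comparison of the forms of H(k) and H(0) -/

/-- Away from zero momentum the form of `H(k) - E_min(k)` lies strictly below that of `H(0)`. -/
lemma inner_hamiltonian_lt {m : ℝ} (hm : 0 < m) (vhat : (Fin 3 → ℤ) → ℝ) {k : Fin 3 → ℝ}
    (hk : ∀ j, k j ∈ Set.Ioo (-Real.pi) Real.pi) (hk0 : k ≠ 0) {f : L2} (hf : f ≠ 0) :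
    (inner ℂ ((freeOp m m k - (energyMin m m k : ℂ) • 1 - interactionOp vhat) f) f).re <
      (inner ℂ (hamiltonian m m vhat 0 f) f).re := by
  obtain ⟨i, hi⟩ := Function.ne_iff.1 hk0
  rw [hamiltonian, _root_.sub_apply, _root_.sub_apply _ (interactionOp vhat), inner_sub_left,
    inner_sub_left, inner_freeOp_sub_energyMin_self, inner_freeOp_self, Complex.sub_re,
    Complex.sub_re, Complex.ofReal_re, Complex.ofReal_re]
  refine sub_lt_sub_right ?_ _
  have hint := integrable_mul_norm_sq (continuous_energy m m 0) f
  have hint' := integrable_mul_norm_sq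
    ((continuous_energy m m k).sub (continuous_const (y := energyMin m m k))) f
  have hlt : ∀ᵐ q : Torus, energy m m k q - energyMin m m k < energy m m 0 q := by
    filter_upwards [ae_apply_ne_zero i] with q hq
    exact energy_sub_energyMin_lt hm hk hi hq
  have hle : (fun q => (energy m m k q - energyMin m m k) * ‖f q‖ ^ 2) ≤ᵐ[volume]
      fun q => energy m m 0 q * ‖f q‖ ^ 2 := by
    filter_upwards [hlt] with q hq
    exact mul_le_mul_of_nonneg_right hq.le (sq_nonneg _)
  -- Equal integrals would force the ordered integrands to agree almost everywhere, hence f = 0.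
  refine lt_of_le_of_ne (integral_mono_ae hint' hint hle) fun h => hf ?_
  have h0 := (integral_eq_iff_of_ae_le hint' hint hle).1 h
  refine Lp.eq_zero_iff_ae_eq_zero.2 ?_
  filter_upwards [hlt, h0] with q h1 h2
  have h3 : (energy m m 0 q - (energy m m k q - energyMin m m k)) * ‖f q‖ ^ 2 = 0 :=
    (sub_mul _ _ _).trans (sub_eq_zero.2 h2.symm)
  simpa [(sub_pos.2 h1).ne'] using h3

/-- Positivity of `H(0)` passes to `H(k)`, whose form is the mean of two forms unitarily equivalent
to that of `H(0)`. -/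
lemma inner_hamiltonian_nonneg {m : ℝ} {vhat : (Fin 3 → ℤ) → ℝ}
    (h0 : (hamiltonian m m vhat 0).IsPositive) (k : Fin 3 → ℝ) (f : L2) :
    0 ≤ (inner ℂ (hamiltonian m m vhat k f) f).re := by
  have h (a : Torus) : 0 ≤ (∫ q, energy m m 0 (q - a) * ‖f q‖ ^ 2) -
      (inner ℂ (interactionOp vhat f) f).re := by
    -- Translation is isometric and commutes with V, so testing H(0) on a translate of f shifts only
    -- the energy.
    have h1 := h0.re_inner_nonneg_left (translate a f)
    rwa [hamiltonian, _root_.sub_apply, inner_sub_left, inner_freeOp_translate, interactionOp,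
      convolutionOp_translate, inner_translate, RCLike.re_to_complex, Complex.sub_re,
      Complex.ofReal_re] at h1
  have hc (a : Torus) : Integrable (fun q => energy m m 0 (q - a) * ‖f q‖ ^ 2) :=
    integrable_mul_norm_sq ((continuous_energy m m 0).comp (by fun_prop)) f
  have h2 : ∫ q, energy m m k q * ‖f q‖ ^ 2 =
      ((∫ q, energy m m 0 (q - halfMomentum k) * ‖f q‖ ^ 2) +
        ∫ q, energy m m 0 (q - -halfMomentum k) * ‖f q‖ ^ 2) / 2 := by
    rw [← integral_add (hc _) (hc _), ← integral_div]
    refine integral_congr_ae (Eventually.of_forall fun q => ?_)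
    simp only [energy_eq_average m k q]
    ring
  rw [hamiltonian, _root_.sub_apply, inner_sub_left, inner_freeOp_self, Complex.sub_re,
    Complex.ofReal_re, h2]
  linarith [h (halfMomentum k), h (-halfMomentum k)]

end LatticePair

end

/-- Equal masses. If `0` is an eigenvalue of `H(0)` of multiplicity `n`, then for every nonzero
`k ∈ (-π, π)³` the operator `H(k)` has at least `n` eigenvalues, counted with multiplicity, below
`E_min(k)`, and they are nonnegative as soon as `H(0) ≥ 0`. -/
theorem corollary6p7 (m : ℝ) (hm : 0 < m) (vhat : (Fin 3 → ℤ) → ℝ)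
    (hv : LatticePair.IsInteraction vhat) (n : ℕ)
    (hn : Module.finrank ℂ (Module.End.eigenspace
      (LatticePair.hamiltonian m m vhat 0 : LatticePair.L2 →ₗ[ℂ] LatticePair.L2) 0) = n)
    (k : Fin 3 → ℝ) (hk : ∀ j, k j ∈ Set.Ioo (-Real.pi) Real.pi) (hk0 : k ≠ 0) :
    ∃ (μ : Fin n → ℝ) (f : Fin n → LatticePair.L2), Orthonormal ℂ f ∧
      ∀ i, Module.End.HasEigenvector
          (LatticePair.hamiltonian m m vhat k : LatticePair.L2 →ₗ[ℂ] LatticePair.L2) (μ i) (f i) ∧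
        μ i < LatticePair.energyMin m m k ∧
        ((LatticePair.hamiltonian m m vhat 0).IsPositive → 0 ≤ μ i) := by
  -- `finrank` is also 0 in infinite dimension, where nothing is claimed; for n > 0 it certifies a
  -- finite-dimensional eigenspace.
  rcases n.eq_zero_or_pos with rfl | hpos
  · exact ⟨Fin.elim0, Fin.elim0, ⟨fun i => i.elim0, fun i => i.elim0⟩, fun i => i.elim0⟩
  have hfin := FiniteDimensional.of_finrank_pos (hn.symm ▸ hpos)
  obtain ⟨μ, f, hf, hμ⟩ := exists_orthonormal_neg_eigenvectors
    (LatticePair.isPositive_freeOp_sub_energyMin m m k) n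
    (LatticePair.isSymmetric_interactionOp hv) (LatticePair.isCompactOperator_interactionOp hv)
    _ hn.ge (fun x hx hx0 => by
      refine (LatticePair.inner_hamiltonian_lt hm vhat hk hk0 hx0).trans_eq ?_
      have h : LatticePair.hamiltonian m m vhat 0 x = 0 := by
        simpa using Module.End.mem_eigenspace_iff.1 hx
      simp [h])
  set E := LatticePair.energyMin m m k
  have heig (i : Fin n) :
      LatticePair.hamiltonian m m vhat k (f i) = ((μ i + E : ℝ) : ℂ) • f i := by
    have h := (hμ i).2
    rw [_root_.sub_apply, _root_.sub_apply, _root_.smul_apply, one_apply_eq_self, sub_right_comm,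
      sub_eq_iff_eq_add, ← add_smul, ← Complex.ofReal_add] at h
    exact h
  refine ⟨fun i => μ i + E, f, hf, fun i => ⟨?_, by linarith [(hμ i).1], fun h0 => ?_⟩⟩
  · exact ⟨Module.End.mem_eigenspace_iff.2 (heig i), hf.ne_zero i⟩
  -- At a unit eigenvector the form equals the eigenvalue.
  · have h := LatticePair.inner_hamiltonian_nonneg h0 k (f i)
    rw [heig, inner_smul_left, Complex.conj_ofReal, inner_self_eq_norm_sq_to_K, hf.1 i] at h
    simpa using h
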